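/- Let $\mathfrak m$ be an uncountable cardinal such that $\sup\{\mathfrak m^{\mathfrak n} : \mathfrak n \text{ a cardinal},\ \mathfrak n<\mathfrak m\}=\mathfrak m$. The weight of a topological space is the least cardinality of a base of its topology. A universal Urysohn metric space of weight $\mathfrak m$ is a metric space $\mathbb U_{\mathfrak m}$ such that: its weight is $\mathfrak m$; every isometry of $A$ onto $B$, where $A,B\subseteq\mathbb U_{\mathfrak m}$ are subsets of cardinality $<\mathfrak m$, extends to an isometry of $\mathbb U_{\mathfrak m}$ onto itself; and every metric space of weight $\le\mathfrak m$ embeds isometrically into $\mathbb U_{\mathfrak m}$. Let $\mathrm{Iso}(\mathbb U_{\mathfrak m})$ be the group of all isometries of $\mathbb U_{\mathfrak m}$ onto itself, with the topology of pointwise convergence. A $P_{\mathfrak m}$-group is a topological group in which the intersection of every family of fewer than $\mathfrak m$ open sets is open. Then a universal Urysohn metric space of weight $\mathfrak m$ exists, and for every such space $\mathbb U_{\mathfrak m}$, every Hausdorff $P_{\mathfrak m}$-group $G$ of weight $\le\mathfrak m$ (in particular every one of weight $\mathfrak m$) is isomorphic, as a topological group, to a subgroup of $\mathrm{Iso}(\mathbb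 U_{\mathfrak m})$. -/

import Mathlib

universe u

/-- The weight of a topological space: the least cardinality of a base of its topology. -/
noncomputable def topWeight (X : Type u) [TopologicalSpace X] : Cardinal.{u} :=
  sInf {c : Cardinal.{u} | ∃ B : Set (Set X),
    TopologicalSpace.IsTopologicalBasis B ∧ Cardinal.mk B = c}

/-- `X` is `τ`-homogeneous: every (surjective) isometry between two subsets of cardinality `< τ`
extends to an isometry of `X` onto itself. -/
def IsCardHomogeneous (τ : Cardinal.{u}) (X : Type u) [MetricSpace X] : Prop :=
  ∀ A B : Set X, Cardinal.mk A < τ → Cardinal.mk B < τ →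
    ∀ f : A ≃ᵢ B, ∃ g : X ≃ᵢ X, ∀ a : A, g a = f a

/-- `X` is strongly `τ`-universal: every metric space of weight `≤ τ` embeds isometrically. -/
def IsStronglyCardUniversal (τ : Cardinal.{u}) (X : Type u) [MetricSpace X] : Prop :=
  ∀ (Y : Type u) [MetricSpace Y], topWeight Y ≤ τ → ∃ i : Y → X, Isometry i

/-- `X` is a universal Urysohn(–Katětov) metric space of weight `τ`. -/
structure IsUrysohnUniversal (τ : Cardinal.{u}) (X : Type u) [MetricSpace X] : Prop where
  weight_eq : topWeight X = τ
  homogeneous : IsCardHomogeneous τ X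
  universal : IsStronglyCardUniversal τ X

/-- The topology of pointwise convergence on the group `X ≃ᵢ X` of isometries of `X` onto itself,
i.e. the one induced by the product topology of `X → X`. -/
instance isoPointwiseTopology (X : Type u) [MetricSpace X] : TopologicalSpace (X ≃ᵢ X) :=
  TopologicalSpace.induced (fun g : X ≃ᵢ X => (g : X → X)) inferInstance

/-- The `P_τ` property: every intersection of fewer than `τ` open sets is open. -/
def IsPSpace (τ : Cardinal.{u}) (G : Type u) [TopologicalSpace G] : Prop :=
  ∀ S : Set (Set G), Cardinal.mk S < τ → (∀ s ∈ S, IsOpen s) → IsOpen (⋂₀ S)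

/-!
# Universal Urysohn spaces and groups of isometries

The spaces in question are characterized, among metric spaces of cardinality at most `m`, by the
Katětov extension property `HasKatetovExtension m`: every prescribed family of distances to fewer
than `m` points that satisfies the triangle inequalities is realized by a point. By a transfinite
back-and-forth of length `m`, any two such spaces are isometric
(`HasKatetovExtension.exists_isometryEquiv`), which also gives homogeneity.

To obtain one over a given metric space `X`, iterate the adjunction of points with prescribed
distances to fewer than `m` earlier points. Instead of a transfinite chain of spaces, all new points
are introduced at once, as well-founded terms: a term is a point of `X` or a family of fewer than
`m` terms with prescribed distances. The distance between two terms is the length of a shortest path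
along these prescribed distances. On the terms whose prescribed distances are hereditarily
consistent it is a pseudometric (`Admissible.termDist_triangle`, by induction on the multiset of the
three terms involved), and it gives a new point the prescribed distances
(`Admissible.termDist_child`). The associated metric space is the tower over `X`. As
`m ^ c ≤ m` for `c < m`, there are at most `m` terms over a space of cardinality at most `m`. Since
weight at most `m` means cardinality at most `m` for metric spaces, the tower over a point is a
universal Urysohn space: a given space `Y` embeds in the tower over `Y`, which is isometric to it.
Conversely every universal Urysohn space has the extension property.

The construction is functorial: a group acting on `X` by isometries acts on the tower. In a
`P_m`-group with `m` uncountable, the open subgroups form a base at the identity. Hence `G` acts on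
the discrete sum of at most `m` coset spaces `G ⧸ H`, with open stabilizers that recognize the
neighbourhoods of the identity (`IsPSpace.exists_isIsometricSMul`). Stabilizers in the tower over
this sum are still open, being large enough to contain an intersection of fewer than `m` stabilizers
of earlier points (`Tower.isOpen_stabilizer`). So the action on the tower is continuous and embeds
`G` in its isometry group, and the tower is isometric to the given Urysohn space.
-/

open Cardinal Set Filter Topology
open scoped ENNReal NNReal

/-! ### The path distance between terms -/

namespace KatetovTower

/-- Labels of the nodes of a term over `X`: a label is either a point of `X`, or an index `k`
together with a family of prescribed distances indexed by `L k`. -/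
abbrev Label (X : Type u) {K : Type u} (L : K → Type u) : Type u :=
  X ⊕ Σ k, (L k → ℝ≥0)

/-- The children of a node: none for a point of `X`, a family indexed by `L k` otherwise. -/
abbrev Arity {X : Type u} {K : Type u} {L : K → Type u} : Label X L → Type u
  | .inl _ => PEmpty
  | .inr p => L p.1

/-- Formal points of the tower over `X`. A term is either a point of `X`, or stands for a new point
attached to a family of earlier terms, with prescribed distances to the members of the family. -/
abbrev Term (X : Type u) {K : Type u} (L : K → Type u) : Type u :=
  WType (Arity (X := X) (L := L))

variable {X : Type u} {K : Type u} {L : K → Type u}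

/-- The prescribed distance from a term to one of its children. -/
def weight : (a : Label X L) → Arity a → ℝ≥0
  | .inl _ => PEmpty.elim
  | .inr p => p.2

variable [PseudoEMetricSpace X]

/-- The distance between labels that are points of `X`, and `⊤` if one of the labels is not. -/
noncomputable def labelDist : Label X L → Label X L → ℝ≥0∞
  | .inl x, .inl y => edist x y
  | _, _ => ⊤

open Classical in
/-- The path distance between terms: the infimum of the lengths of the paths that descend from `s`
along children, move inside `X`, and ascend to `t`, where a step from a term to a child has the
prescribed length. A proper path between terms not both in `X` starts by descending from `s` or ends
by ascending to `t`. Infima over the empty family of children are `⊤`. -/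
noncomputable def termDist : Term X L → Term X L → ℝ≥0∞
  | .mk a A => fun t => WType.rec (motive := fun _ => ℝ≥0∞)
      (fun b B ih => if WType.mk a A = WType.mk b B then 0 else
        labelDist a b ⊓ (⨅ i, weight a i + termDist (A i) (.mk b B)) ⊓ ⨅ j, ih j + weight b j) t

theorem termDist_self (s : Term X L) : termDist s s = 0 := by
  cases s; exact if_pos rfl

theorem termDist_mk_of_ne {a b : Label X L} {A B} (h : WType.mk a A ≠ WType.mk b B) :
    termDist (.mk a A) (.mk b B) = labelDist a b ⊓ (⨅ i, weight a i + termDist (A i) (.mk b B)) ⊓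
      ⨅ j, termDist (.mk a A) (B j) + weight b j :=
  if_neg h

theorem labelDist_comm (a b : Label X L) : labelDist a b = labelDist b a := by
  rcases a with x | p <;> rcases b with y | q <;> simp [labelDist, edist_comm]

theorem termDist_comm (s t : Term X L) : termDist s t = termDist t s := by
  induction s generalizing t with | mk a A ihs
  induction t with | mk b B iht
  by_cases h : WType.mk a A = WType.mk b B
  · rw [h]
  · rw [termDist_mk_of_ne h, termDist_mk_of_ne (Ne.symm h), labelDist_comm, inf_right_comm]
    simp only [ihs, iht, add_comm]

theorem termDist_le_labelDist (a b : Label X L) (A B) :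
    termDist (.mk a A) (.mk b B) ≤ labelDist a b := by
  by_cases h : WType.mk a A = WType.mk b B
  · rw [h, termDist_self]; exact zero_le
  · rw [termDist_mk_of_ne h]; exact inf_le_left.trans inf_le_left

theorem termDist_le_left (a : Label X L) (A) (t : Term X L) (i : Arity a) :
    termDist (.mk a A) t ≤ weight a i + termDist (A i) t := by
  obtain ⟨b, B⟩ := t
  by_cases h : WType.mk a A = WType.mk b B
  · rw [h, termDist_self]; exact zero_le
  · rw [termDist_mk_of_ne h]; exact inf_le_left.trans (inf_le_right.trans (iInf_le _ i))

theorem termDist_le_right (s : Term X L) (b : Label X L) (B) (j : Arity b) :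
    termDist s (.mk b B) ≤ termDist s (B j) + weight b j := by
  rw [termDist_comm, termDist_comm s, add_comm]; exact termDist_le_left ..

/-- `Child s t` says that `s` is one of the children of `t`. -/
def Child (s : Term X L) : Term X L → Prop
  | .mk a A => ∃ i : Arity a, A i = s

omit [PseudoEMetricSpace X] in
theorem child_mk (a : Label X L) (A) (i : Arity a) : Child (A i) (.mk a A) := ⟨i, rfl⟩

omit [PseudoEMetricSpace X] in
theorem wellFounded_child : WellFounded (Child (X := X) (L := L)) := by
  refine ⟨fun t => ?_⟩
  induction t with | mk a A ih
  exact ⟨_, fun s ⟨i, hi⟩ => hi ▸ ih i⟩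

/-- A term is admissible if all its children are, and if the prescribed distances form a Katětov
function on the family of the children. -/
def Admissible : Term X L → Prop
  | .mk a A => (∀ i, Admissible (A i)) ∧ ∀ i j : Arity a,
      (weight a i : ℝ≥0∞) ≤ weight a j + termDist (A j) (A i) ∧
        termDist (A i) (A j) ≤ weight a i + weight a j

theorem labelDist_eq_top_left {a b : Label X L} (i : Arity a) : labelDist a b = ⊤ := by
  rcases a with x | p
  · exact i.elim
  · simp [labelDist]

theorem labelDist_eq_top_right {a b : Label X L} (i : Arity b) : labelDist a b = ⊤ := by
  rw [labelDist_comm, labelDist_eq_top_left i]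

theorem labelDist_triangle (a b c : Label X L) :
    labelDist a c ≤ labelDist a b + labelDist b c := by
  rcases a with x | p <;> rcases b with y | q <;> rcases c with z | r <;>
    simp [labelDist, edist_triangle]

/-- The induction is on the multiset `{s, t, u}`, where an element may be replaced by any number of
its children. This order allows the middle term to be replaced by two of its children, at the
expense of dropping an end. -/
theorem Admissible.termDist_triangle {s t u : Term X L} (hs : Admissible s) (ht : Admissible t)
    (hu : Admissible u) : termDist s u ≤ termDist s t + termDist t u := by
  suffices H : ∀ M : Multiset (Term X L), ∀ s t u, Admissible s → Admissible t → Admissible u →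
      M = {s, t, u} → termDist s u ≤ termDist s t + termDist t u from H _ s t u hs ht hu rfl
  have : Std.Irrefl (Child (X := X) (L := L)) :=
    wellFounded_child.irrefl
  intro M
  induction M using (wellFounded_child (X := X) (L := L)).cutExpand.transGen.induction with | _ M ih
  rintro ⟨a, A⟩ ⟨b, B⟩ ⟨c, C⟩ hs ht hu rfl
  by_cases hst : WType.mk a A = WType.mk b B
  · rw [hst, termDist_self, zero_add]
  by_cases htu : WType.mk b B = WType.mk c C
  · rw [htu, termDist_self, add_zero]
  -- A path that descends from its first end, and a path that ascends to its last end.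
  have left (i) : termDist (.mk a A) (.mk c C) ≤
      weight a i + termDist (A i) (.mk b B) + termDist (.mk b B) (.mk c C) := by
    refine (termDist_le_left _ _ _ i).trans ?_
    rw [add_assoc]
    gcongr
    refine ih _ (.single ?_) _ _ _ (hs.1 i) ht hu rfl
    exact Relation.cutExpand_single_add (child_mk a A i) {.mk b B, .mk c C}
  have right (k) : termDist (.mk a A) (.mk c C) ≤
      termDist (.mk a A) (.mk b B) + (termDist (.mk b B) (C k) + weight c k) := by
    refine (termDist_le_right _ _ _ k).trans ?_
    rw [← add_assoc]
    gcongr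
    refine ih _ (.single ?_) _ _ _ hs ht (hu.1 k) rfl
    exact (Relation.cutExpand_add_left {_, _}).2
      (Relation.cutExpand_singleton_singleton (child_mk c C k))
  -- A path that ascends to the middle term and descends again can be shortened.
  have mid (j k) : termDist (.mk a A) (.mk c C) ≤
      termDist (.mk a A) (B j) + weight b j + (weight b k + termDist (B k) (.mk c C)) := by
    have h₁ : termDist (.mk a A) (.mk c C) ≤
        termDist (.mk a A) (B k) + termDist (B k) (.mk c C) := by
      refine ih _ (.single ?_) _ _ _ hs (ht.1 k) hu rfl
      exact (Relation.cutExpand_add_left {_}).2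
        (Relation.cutExpand_single_add (child_mk b B k) {.mk c C})
    have h₂ : termDist (.mk a A) (B k) ≤ termDist (.mk a A) (B j) + termDist (B j) (B k) := by
      refine ih _ (.tail (b := {.mk a A, .mk b B}) (.single ?_) ?_) _ _ _
        hs (ht.1 j) (ht.1 k) rfl
      · refine (Relation.cutExpand_add_left {_}).2 (Relation.cutExpand_double ?_ ?_)
        exacts [child_mk b B j, child_mk b B k]
      · have := (Relation.cutExpand_add_left {.mk a A, .mk b B}).2
          (Relation.cutExpand_zero (r := Child) (x := WType.mk c C))
        exact this
    calc _ ≤ _ := h₁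
      _ ≤ termDist (.mk a A) (B j) + termDist (B j) (B k) + termDist (B k) (.mk c C) := by
        gcongr
      _ ≤ termDist (.mk a A) (B j) + (weight b j + weight b k) + termDist (B k) (.mk c C) := by
        gcongr; exact (ht.2 j k).2
      _ = _ := by ring
  rw [termDist_mk_of_ne hst, min_add, min_add, ENNReal.iInf_add, ENNReal.iInf_add]
  refine le_inf (le_inf ?_ (le_iInf left)) (le_iInf fun j => ?_)
  · rw [termDist_mk_of_ne htu, add_min, add_min, ENNReal.add_iInf, ENNReal.add_iInf]
    refine le_inf (le_inf ?_ (le_iInf fun k => ?_)) (le_iInf fun k => ?_)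
    · exact (termDist_le_labelDist ..).trans (labelDist_triangle a b c)
    · rw [labelDist_eq_top_right k, top_add]; exact le_top
    · exact (right k).trans (by gcongr; exact termDist_le_labelDist ..)
  · rw [termDist_mk_of_ne htu, add_min, add_min, ENNReal.add_iInf, ENNReal.add_iInf]
    refine le_inf (le_inf ?_ (le_iInf fun k => mid j k)) (le_iInf fun k => ?_)
    · rw [labelDist_eq_top_left j, add_top]; exact le_top
    · exact (right k).trans (by gcongr; exact termDist_le_right ..)

/-- The distance from an admissible term to a child is the prescribed one: a detour through other
children does not shorten it. -/
theorem Admissible.termDist_child {a : Label X L} {A} (hs : Admissible (.mk a A)) (i : Arity a) :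
    termDist (.mk a A) (A i) = weight a i := by
  refine le_antisymm ((termDist_le_left _ _ _ i).trans (by rw [termDist_self, add_zero])) ?_
  -- Below `s`, all shortest paths from `s` start by descending.
  have key (t : Term X L) (ht : Admissible t) (hlt : Relation.TransGen Child t (.mk a A)) :
      ⨅ j, weight a j + termDist (A j) t ≤ termDist (.mk a A) t := by
    induction t with | mk b B ih
    have hne : WType.mk a A ≠ WType.mk b B := fun h => by
      rw [← h] at hlt
      exact wellFounded_child.transGen.irrefl.irrefl _ hlt
    rw [termDist_mk_of_ne hne]
    refine le_inf (le_inf ?_ le_rfl) (le_iInf fun k => ?_)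
    · rw [labelDist_eq_top_left i]; exact le_top
    · refine le_trans ?_
        (add_le_add_left (ih k (ht.1 k) (.head (child_mk b B k) hlt)) _)
      rw [ENNReal.iInf_add]
      refine iInf_mono fun j => ?_
      rw [add_assoc]
      gcongr
      exact termDist_le_right ..
  refine le_trans (le_iInf fun j => ?_) (key (A i) (hs.1 i) (.single ⟨i, rfl⟩))
  exact (hs.2 i j).1

theorem termDist_ne_top [∀ k, Nonempty (L k)] (hX : ∀ x y : X, edist x y ≠ ⊤) (s t : Term X L) :
    termDist s t ≠ ⊤ := by
  induction s generalizing t with | mk a A ihs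
  rcases a with x | ⟨k, f⟩
  · induction t with | mk b B iht
    rcases b with y | ⟨l, g⟩
    · exact ne_top_of_le_ne_top (hX x y) (termDist_le_labelDist ..)
    · obtain ⟨j⟩ := ‹∀ k, Nonempty (L k)› l
      exact ne_top_of_le_ne_top (ENNReal.add_ne_top.2 ⟨iht j, ENNReal.coe_ne_top⟩)
        (termDist_le_right _ (.inr ⟨l, g⟩) B j)
  · obtain ⟨i⟩ := ‹∀ k, Nonempty (L k)› k
    exact ne_top_of_le_ne_top (ENNReal.add_ne_top.2 ⟨ENNReal.coe_ne_top, ihs i t⟩)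
      (termDist_le_left (.inr ⟨k, f⟩) A t i)

section Action

variable {G : Type*} [Group G] [MulAction G X]

omit [PseudoEMetricSpace X]

/-- An element of the group acts on a term by acting on the points of `X` that occur in it. -/
def smulTerm (g : G) : Term X L → Term X L
  | .mk (.inl x) _ => .mk (.inl (g • x)) PEmpty.elim
  | .mk (.inr p) A => .mk (.inr p) fun i => smulTerm g (A i)

instance : SMul G (Term X L) := ⟨smulTerm⟩

theorem smul_inl (g : G) (x : X) (A) :
    g • (WType.mk (.inl x) A : Term X L) = .mk (.inl (g • x)) PEmpty.elim := rfl

theorem smul_inr (g : G) (p) (A) :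
    g • (WType.mk (.inr p) A : Term X L) = .mk (.inr p) fun i => g • A i := rfl

instance : MulAction G (Term X L) where
  one_smul t := by
    induction t with | mk a A ih
    rcases a with x | p
    · rw [smul_inl, one_smul]
      congr 1
      exact Subsingleton.elim _ _
    · rw [smul_inr]; congr 1; exact funext ih
  mul_smul g h t := by
    induction t with | mk a A ih
    rcases a with x | p
    · rw [smul_inl, smul_inl, smul_inl, mul_smul]
    · simp only [smul_inr]; congr 1; exact funext ih

variable [PseudoEMetricSpace X] [IsIsometricSMul G X]

theorem termDist_smul (g : G) (s t : Term X L) : termDist (g • s) (g • t) = termDist s t := by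
  induction s generalizing t with | mk a A ihs
  induction t with | mk b B iht
  by_cases h : WType.mk a A = WType.mk b B
  · rw [h, termDist_self, termDist_self]
  have h' : g • WType.mk a A ≠ g • WType.mk b B := fun e => h (MulAction.injective g e)
  rcases a with x | p <;> rcases b with y | q <;>
    simp only [smul_inl, smul_inr] at h' ihs iht ⊢ <;>
    rw [termDist_mk_of_ne h, termDist_mk_of_ne h'] <;>
    simp [labelDist, weight, ← ihs, ← iht, smul_inl, smul_inr]

theorem Admissible.smul (g : G) {t : Term X L} (ht : Admissible t) : Admissible (g • t) := by
  induction t with | mk a A ih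
  rcases a with x | p
  · exact ⟨nofun, nofun⟩
  · refine ⟨fun i => ih i (ht.1 i), fun i j => ?_⟩
    change _ ≤ _ + termDist (g • A j) (g • A i) ∧ termDist (g • A i) (g • A j) ≤ _
    rw [termDist_smul, termDist_smul]
    exact ht.2 i j

end Action

end KatetovTower

/-! ### The extension property -/

/-- Every Katětov function on a subset of cardinality `< m` is the distance to some point. For the
empty subset this says that the space is nonempty. -/
def HasKatetovExtension (m : Cardinal.{u}) (Z : Type u) [MetricSpace Z] : Prop :=
  ∀ A : Set Z, #A < m → ∀ f : Z → ℝ,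
    (∀ a ∈ A, ∀ b ∈ A, f a ≤ f b + dist a b ∧ dist a b ≤ f a + f b) → ∃ z, ∀ a ∈ A, dist z a = f a

/-! ### The tower as a metric space -/

namespace KatetovTower

section Space

variable (X : Type u) {K : Type u} (L : K → Type u)

/-- The admissible terms, with the path distance as a pseudometric. -/
abbrev AdmissibleTerm [PseudoEMetricSpace X] : Type u := {t : Term X L // Admissible t}

variable {L} [MetricSpace X] [∀ k, Nonempty (L k)]

noncomputable instance : PseudoMetricSpace (AdmissibleTerm X L) :=
  letI : PseudoEMetricSpace (AdmissibleTerm X L) :=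
    { edist s t := termDist s.1 t.1
      edist_self s := termDist_self s.1
      edist_comm s t := termDist_comm s.1 t.1
      edist_triangle s t u := s.2.termDist_triangle t.2 u.2 }
  PseudoEMetricSpace.toPseudoMetricSpace fun s t => termDist_ne_top edist_ne_top s.1 t.1

variable {X}

theorem edist_admissibleTerm (s t : AdmissibleTerm X L) : edist s t = termDist s.1 t.1 := rfl

/-- A point of `X` as an admissible term. -/
def AdmissibleTerm.of (x : X) : AdmissibleTerm X L := ⟨.mk (.inl x) PEmpty.elim, nofun, nofun⟩

theorem AdmissibleTerm.isometry_of : Isometry (of : X → AdmissibleTerm X L) := fun x y => by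
  rw [edist_admissibleTerm]
  by_cases h : x = y
  · rw [h, termDist_self, edist_self]
  · refine (termDist_mk_of_ne fun e => h ?_).trans ?_
    · injection e with e _; exact Sum.inl_injective e
    · simp [labelDist]

variable (X L)

/-- The Katětov tower over `X`: the metric space associated with the admissible terms. -/
abbrev Tower : Type u := SeparationQuotient (AdmissibleTerm X L)

variable {X L}

/-- The embedding of `X` into the tower over it. -/
noncomputable def Tower.of (x : X) : Tower X L := .mk (.of x)

theorem Tower.isometry_of : Isometry (of : X → Tower X L) := fun x y => by
  simp only [of, SeparationQuotient.edist_mk, AdmissibleTerm.isometry_of x y]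

theorem Tower.hasKatetovExtension [Nonempty X] {m : Cardinal.{u}}
    (hL : ∀ c < m, ∃ k, c ≤ #(L k)) : HasKatetovExtension m (Tower X L) := by
  intro A hA f hf
  rcases A.eq_empty_or_nonempty with rfl | ⟨a₀, ha₀⟩
  · exact ⟨.of (Classical.arbitrary X), nofun⟩
  obtain ⟨k, hk⟩ := hL _ hA
  obtain ⟨e⟩ := hk
  have : Nonempty A := ⟨⟨a₀, ha₀⟩⟩
  -- The points of `A` are listed by `L k` with repetitions, each with a term that represents it.
  let σ : L k → A := Function.invFun e
  have hσ : Function.Surjective σ := Function.invFun_surjective e.injective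
  choose r hr using fun i => SeparationQuotient.surjective_mk (σ i).1
  have hf₀ (i) : 0 ≤ f (σ i) := by
    have := (hf _ (σ i).2 _ (σ i).2).2
    rw [dist_self] at this; linarith
  have hd (i j) : termDist (r i).1 (r j).1 = .ofReal (dist (σ i).1 (σ j).1) := by
    rw [← edist_admissibleTerm, ← SeparationQuotient.edist_mk, hr, hr, edist_dist]
  have hadm : Admissible (X := X) (L := L) (.mk (.inr ⟨k, fun i => (f (σ i)).toNNReal⟩)
      fun i => (r i).1) := by
    refine ⟨fun i => (r i).2, fun i j => ?_⟩
    change ENNReal.ofReal _ ≤ .ofReal _ + _ ∧ _ ≤ ENNReal.ofReal _ + .ofReal _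
    rw [hd, hd, ← ENNReal.ofReal_add (hf₀ _) dist_nonneg,
      ← ENNReal.ofReal_add (hf₀ _) (hf₀ _), dist_comm (σ j).1]
    exact ⟨ENNReal.ofReal_le_ofReal (hf _ (σ i).2 _ (σ j).2).1,
      ENNReal.ofReal_le_ofReal (hf _ (σ i).2 _ (σ j).2).2⟩
  refine ⟨.mk ⟨_, hadm⟩, fun a ha => ?_⟩
  obtain ⟨i, hi⟩ := hσ ⟨a, ha⟩
  obtain rfl : (σ i).1 = a := by rw [hi]
  rw [← hr, SeparationQuotient.dist_mk, ← ENNReal.ofReal_eq_ofReal_iff dist_nonneg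
    (by rw [hr]; exact hf₀ i), ← edist_dist, edist_admissibleTerm, hr]
  exact hadm.termDist_child i

theorem Tower.mk_le {m : Cardinal.{u}} (hm : ℵ₀ < m) (hpow : m ^< m = m) (hX : #X ≤ m)
    (hK : #K ≤ m) (hL : ∀ k, #(L k) < m) : #(Tower X L) ≤ m := by
  have pow_le {c} (hc : c < m) : m ^ c ≤ m := (le_powerlt m hc).trans_eq hpow
  have hlab (k) : #(L k → ℝ≥0) ≤ m := by
    calc #(L k → ℝ≥0) ≤ #(L k → ULift.{u} ℝ) :=
          mk_le_of_injective (f := fun f i => ULift.up (f i : ℝ)) fun f g h => funext fun i =>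
            NNReal.coe_injective (ULift.up_injective (congrFun h i))
      _ = 2 ^ (ℵ₀ * #(L k)) := by rw [power_mul]; simp [mk_real]
      _ ≤ m ^ (ℵ₀ * #(L k)) := power_le_power_right (natCast_lt_aleph0.le.trans hm.le)
      _ ≤ m := pow_le (mul_lt_of_lt hm.le hm (hL k))
  have hsig : #(Σ k, (L k → ℝ≥0)) ≤ m := by
    rw [mk_sigma]
    refine (sum_le_sum _ (fun _ => m) hlab).trans ?_
    rw [sum_const']
    exact (mul_le_mul_left hK m).trans (mul_eq_self hm.le).le
  have hlabel : #(Label X L) ≤ m := by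
    rw [mk_sum, lift_id, lift_id]
    exact (add_le_add hX hsig).trans (add_eq_self hm.le).le
  refine mk_quotient_le.trans ((mk_subtype_le _).trans (WType.cardinalMk_le_of_le ?_))
  refine (sum_le_sum _ (fun _ => m) fun a => pow_le ?_).trans ?_
  · rcases a with x | p
    · simpa using aleph0_pos.trans hm
    · exact hL p.1
  · rw [sum_const']
    exact (mul_le_mul_left hlabel m).trans (mul_eq_self hm.le).le

section Action

variable {G : Type*} [Group G] [MulAction G X] [IsIsometricSMul G X]

instance : MulAction G (AdmissibleTerm X L) where
  smul g t := ⟨g • t.1, t.2.smul g⟩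
  one_smul t := Subtype.ext (one_smul G t.1)
  mul_smul g h t := Subtype.ext (mul_smul g h t.1)

instance : IsIsometricSMul G (AdmissibleTerm X L) :=
  ⟨fun g s t => termDist_smul g s.1 t.1⟩

instance : IsIsometricSMul G (Tower X L) := ⟨fun g s t => by
  obtain ⟨s, rfl⟩ := SeparationQuotient.surjective_mk s
  obtain ⟨t, rfl⟩ := SeparationQuotient.surjective_mk t
  simp only [← SeparationQuotient.mk_smul, SeparationQuotient.edist_mk, edist_smul_left]⟩

theorem Tower.smul_of (g : G) (x : X) : g • (of x : Tower X L) = of (g • x) := rfl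

/-- Stabilizers in the tower are open if those in `X` are: the stabilizer of a new point contains
the intersection of the stabilizers of the fewer than `m` points to which it is attached. -/
theorem Tower.isOpen_stabilizer {G : Type u} [Group G] [MulAction G X] [IsIsometricSMul G X]
    [TopologicalSpace G] [IsTopologicalGroup G]
    {m : Cardinal.{u}} (hG : IsPSpace m G) (hL : ∀ k, #(L k) < m)
    (hX : ∀ x : X, IsOpen (MulAction.stabilizer G x : Set G)) (z : Tower X L) :
    IsOpen (MulAction.stabilizer G z : Set G) := by
  have hterm (t : Term X L) : IsOpen (MulAction.stabilizer G t : Set G) := by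
    induction t with | mk a A ih
    rcases a with x | ⟨k, f⟩
    · refine Subgroup.isOpen_mono (H₁ := MulAction.stabilizer G x) (fun g hg => ?_) (hX x)
      rw [MulAction.mem_stabilizer_iff] at hg ⊢
      rw [smul_inl, hg]
      congr 1
      exact Subsingleton.elim _ _
    · refine Subgroup.isOpen_mono (H₁ := ⨅ i, MulAction.stabilizer G (A i)) (fun g hg => ?_) ?_
      · simp only [Subgroup.mem_iInf, MulAction.mem_stabilizer_iff] at hg
        rw [MulAction.mem_stabilizer_iff, smul_inr]
        congr 1
        exact funext hg
      · rw [Subgroup.coe_iInf, ← sInter_range]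
        exact hG _ (mk_range_le.trans_lt (hL k)) (forall_mem_range.2 ih)
  obtain ⟨t, rfl⟩ := SeparationQuotient.surjective_mk z
  refine Subgroup.isOpen_mono (fun g hg => ?_) (hterm t.1)
  rw [MulAction.mem_stabilizer_iff] at hg ⊢
  rw [← SeparationQuotient.mk_smul]
  congr 1
  exact Subtype.ext hg

end Action

end Space

section Segment

/-- The initial segments of the least well-order of cardinality `m`, as index types for the
families of fewer than `m` terms. They are taken closed to make them nonempty: a term attached to an
empty family would be at infinite distance from the others. -/
abbrev Segment (m : Cardinal.{u}) (k : m.ord.ToType) : Type u := Set.Iic k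

theorem Segment.mk_lt {m : Cardinal.{u}} (hm : ℵ₀ ≤ m) (k : m.ord.ToType) :
    #(Segment m k) < m := by
  simpa using mk_Iic_lt k (by simp) (by simpa using hm)

theorem Segment.exists_le_mk {m : Cardinal.{u}} (c : Cardinal.{u}) (hc : c < m) :
    ∃ k, c ≤ #(Segment m k) := by
  have h : c.ord < Ordinal.type (α := m.ord.ToType) (· < ·) := by simpa using hc
  obtain ⟨k, hk⟩ := Ordinal.typein_surj (α := m.ord.ToType) (· < ·) h
  have hc := Ordinal.card_typein (r := (· < · : m.ord.ToType → m.ord.ToType → Prop)) k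
  rw [hk, card_ord] at hc
  exact ⟨k, hc.trans_le (mk_le_mk_of_subset (s := Iio k) Iio_subset_Iic_self)⟩

end Segment

end KatetovTower

/-! ### Back-and-forth -/

section BackAndForth

/-- Transfinite recursion: if every task can be carried out compatibly with fewer than `m` pairwise
compatible objects, then a family of tasks whose proper initial segments have cardinality `< m` can
be carried out by pairwise compatible objects. -/
theorem exists_pairwise_compatible {α ι : Type u} [LinearOrder ι] [WellFoundedLT ι]
    {m : Cardinal.{u}} (hm : ℵ₀ ≤ m) (hι : ∀ i : ι, #(Iio i) < m) (C : α → α → Prop)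
    (hrefl : ∀ a, C a a) (hsymm : ∀ a b, C a b → C b a) (T : ι → α → Prop)
    (hT : ∀ S : Set α, #S < m → (∀ a ∈ S, ∀ b ∈ S, C a b) → ∀ i, ∃ a, T i a ∧ ∀ b ∈ S, C a b)
    (S₀ : Set α) (hS₀ : #S₀ < m) (hC₀ : ∀ a ∈ S₀, ∀ b ∈ S₀, C a b) :
    ∃ F : ι → α, (∀ i, T i (F i)) ∧ (∀ i j, C (F i) (F j)) ∧ ∀ i, ∀ b ∈ S₀, C (F i) b := by
  rcases isEmpty_or_nonempty α with hα | hα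
  · have : IsEmpty ι := ⟨fun i => let ⟨a, _⟩ := hT S₀ hS₀ hC₀ i; hα.false a⟩
    exact ⟨isEmptyElim, isEmptyElim, isEmptyElim, isEmptyElim⟩
  let F : ι → α := IsWellFounded.fix (· < ·) fun i f =>
    Classical.epsilon fun a => T i a ∧ ∀ b ∈ S₀ ∪ range fun j : Iio i => f j.1 j.2, C a b
  have hF (i) : F i = Classical.epsilon fun a =>
      T i a ∧ ∀ b ∈ S₀ ∪ range fun j : Iio i => F j.1, C a b :=
    IsWellFounded.fix_eq (· < ·) _ i
  have key (i) : T i (F i) ∧ ∀ b ∈ S₀ ∪ range fun j : Iio i => F j.1, C (F i) b := by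
    induction i using WellFoundedLT.induction with | _ i ih
    rw [hF i]
    refine Classical.epsilon_spec (hT _ ?_ ?_ i)
    · exact (mk_union_le _ _).trans_lt (add_lt_of_lt hm hS₀ (mk_range_le.trans_lt (hι i)))
    · rintro _ (ha | ⟨⟨j, hj⟩, rfl⟩) _ (hb | ⟨⟨k, hk⟩, rfl⟩)
      · exact hC₀ _ ha _ hb
      · exact hsymm _ _ ((ih k hk).2 _ (.inl ha))
      · exact (ih j hj).2 _ (.inl hb)
      · rcases lt_trichotomy j k with h | rfl | h
        · exact hsymm _ _ ((ih k hk).2 _ (.inr ⟨⟨j, h⟩, rfl⟩))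
        · exact hrefl _
        · exact (ih j hj).2 _ (.inr ⟨⟨k, h⟩, rfl⟩)
  refine ⟨F, fun i => (key i).1, fun j k => ?_, fun i b hb => (key i).2 b (.inl hb)⟩
  rcases lt_trichotomy j k with h | rfl | h
  · exact hsymm _ _ ((key k).2 _ (.inr ⟨⟨j, h⟩, rfl⟩))
  · exact hrefl _
  · exact (key j).2 _ (.inr ⟨⟨k, h⟩, rfl⟩)

variable {Z Z' : Type u} [MetricSpace Z] [MetricSpace Z'] {m : Cardinal.{u}}

/-- One step of the back-and-forth: a partial isometry, given by its graph `R`, extends to a further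
point. -/
theorem HasKatetovExtension.exists_dist_eq (h : HasKatetovExtension m Z') {R : Set (Z × Z')}
    (hR : #R < m) (hiso : ∀ p ∈ R, ∀ q ∈ R, dist p.1 q.1 = dist p.2 q.2) (z : Z) :
    ∃ z', ∀ q ∈ R, dist z q.1 = dist z' q.2 := by
  have : Nonempty Z := ⟨z⟩
  choose! g hg using fun b (hb : b ∈ Prod.snd '' R) =>
    show ∃ a, (a, b) ∈ R from let ⟨q, hq, e⟩ := hb; ⟨q.1, e ▸ hq⟩
  obtain ⟨z', hz'⟩ := h (Prod.snd '' R) (mk_image_le.trans_lt hR) (fun b => dist z (g b))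
    fun a ha b hb => by
      have hab : dist (g a) (g b) = dist a b := hiso _ (hg a ha) _ (hg b hb)
      rw [← hab]
      refine ⟨?_, dist_triangle_left _ _ _⟩
      rw [dist_comm (g a)]
      exact dist_triangle _ _ _
  refine ⟨z', fun q hq => ?_⟩
  have hmem := mem_image_of_mem Prod.snd hq
  have : g q.2 = q.1 := by
    rw [← dist_eq_zero, hiso _ (hg _ hmem) _ hq, dist_self]
  rw [hz' _ hmem, this]

/-- Back-and-forth: between spaces of cardinality at most `m` with the extension property, every
isometry between subsets of cardinality `< m`, given by its graph, extends to a surjective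
isometry. -/
theorem HasKatetovExtension.exists_isometryEquiv (hm : ℵ₀ ≤ m) (h : HasKatetovExtension m Z)
    (h' : HasKatetovExtension m Z') (hZ : #Z ≤ m) (hZ' : #Z' ≤ m) (R₀ : Set (Z × Z'))
    (hR₀ : #R₀ < m) (hiso : ∀ p ∈ R₀, ∀ q ∈ R₀, dist p.1 q.1 = dist p.2 q.2) :
    ∃ e : Z ≃ᵢ Z', ∀ q ∈ R₀, e q.1 = q.2 := by
  obtain ⟨z₀, -⟩ := h ∅ (by simpa using aleph0_pos.trans_le hm) 0 nofun
  -- The tasks: every point of either space has to occur in the graph.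
  obtain ⟨τ, hτ⟩ : ∃ τ : m.ord.ToType → Z ⊕ Z', Function.Surjective τ := by
    have : #(Z ⊕ Z') ≤ #m.ord.ToType := by
      rw [mk_sum, lift_id, lift_id, mk_ord_toType]
      exact (add_le_add hZ hZ').trans (add_eq_self hm).le
    obtain ⟨e⟩ := this
    have : Nonempty (Z ⊕ Z') := ⟨.inl z₀⟩
    exact ⟨_, Function.invFun_surjective e.injective⟩
  obtain ⟨F, hF, hFF, hF₀⟩ := exists_pairwise_compatible (ι := m.ord.ToType) hm
    (fun i => by simpa using mk_Iio_lt i (by simp))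
    (fun p q : Z × Z' => dist p.1 q.1 = dist p.2 q.2) (fun p => by simp)
    (fun p q hpq => by rw [dist_comm, hpq, dist_comm])
    (fun i p => Sum.elim (fun z => p.1 = z) (fun z' => p.2 = z') (τ i))
    (fun S hS hSS i => by
      rcases τ i with z | z'
      · obtain ⟨z', hz'⟩ := h'.exists_dist_eq hS hSS z
        exact ⟨(z, z'), rfl, hz'⟩
      · obtain ⟨z, hz⟩ := h.exists_dist_eq (R := Prod.swap '' S) (mk_image_le.trans_lt hS)
          (by
            rintro _ ⟨p, hp, rfl⟩ _ ⟨q, hq, rfl⟩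
            exact (hSS p hp q hq).symm) z'
        exact ⟨(z, z'), rfl, fun q hq => (hz _ (mem_image_of_mem _ hq)).symm⟩)
    R₀ hR₀ hiso
  choose i hi using fun z => hτ (.inl z)
  have hfst (z) : (F (i z)).1 = z := by simpa [hi] using hF (i z)
  have hsnd (z) (p : Z × Z') (hp : dist (F (i z)).1 p.1 = dist (F (i z)).2 p.2) (e : z = p.1) :
      (F (i z)).2 = p.2 := by
    rw [← dist_eq_zero, ← hp, hfst, e, dist_self]
  have hisom : Isometry fun z => (F (i z)).2 := Isometry.of_dist_eq fun z w => by
    rw [← hFF, hfst, hfst]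
  refine ⟨IsometryEquiv.mk (.ofBijective _ ⟨hisom.injective, fun z' => ?_⟩) hisom,
    fun q hq => hsnd q.1 q (hF₀ _ q hq) rfl⟩
  obtain ⟨j, hj⟩ := hτ (.inr z')
  have hz' : (F j).2 = z' := by simpa [hj] using hF j
  exact ⟨(F j).1, (hsnd _ _ (hFF _ j) rfl).trans hz'⟩

theorem HasKatetovExtension.isCardHomogeneous (hm : ℵ₀ ≤ m) (h : HasKatetovExtension m Z)
    (hZ : #Z ≤ m) : IsCardHomogeneous m Z := by
  intro A B hA _ f
  obtain ⟨e, he⟩ := h.exists_isometryEquiv hm h hZ hZ (range fun a : A => (a.1, (f a).1))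
    (mk_range_le.trans_lt hA) (by
      rintro _ ⟨a, rfl⟩ _ ⟨b, rfl⟩
      exact (f.isometry.dist_eq a b).symm)
  exact ⟨e, fun a => he _ ⟨a, rfl⟩⟩

end BackAndForth

/-! ### Weight and cardinality -/

section Weight

theorem exists_isTopologicalBasis_mk_eq_topWeight (X : Type u) [TopologicalSpace X] :
    ∃ B : Set (Set X), TopologicalSpace.IsTopologicalBasis B ∧ #B = topWeight X :=
  csInf_mem (s := {c | ∃ B : Set (Set X), TopologicalSpace.IsTopologicalBasis B ∧ #B = c})
    ⟨_, _, TopologicalSpace.isTopologicalBasis_opens, rfl⟩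

/-- The cardinality of a family of pairwise disjoint nonempty open sets is at most the weight. -/
theorem mk_le_topWeight {X D : Type u} [TopologicalSpace X] (V : D → Set X) (x : D → X)
    (hV : ∀ i, IsOpen (V i)) (hx : ∀ i, x i ∈ V i) (hdisj : ∀ i j, x i ∈ V j → i = j) :
    #D ≤ topWeight X := by
  obtain ⟨B, hB, hBX⟩ := exists_isTopologicalBasis_mk_eq_topWeight X
  choose b hb hxb hbV using fun i => hB.exists_subset_of_mem_open (hx i) (hV i)
  rw [← hBX]
  refine mk_le_of_injective (f := fun i => (⟨b i, hb i⟩ : B)) fun i j hij => hdisj i j (hbV j ?_)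
  have : b i = b j := congrArg Subtype.val hij
  exact this ▸ hxb i

variable {Y : Type u} [MetricSpace Y]

theorem topWeight_le_of_mk_le {m : Cardinal.{u}} (hm : ℵ₀ ≤ m) (hY : #Y ≤ m) :
    topWeight Y ≤ m := by
  let B : Set (Set Y) := range fun p : Y × ULift.{u} ℕ => Metric.ball p.1 (1 / (p.2.down + 1))
  have hB : TopologicalSpace.IsTopologicalBasis B := by
    refine TopologicalSpace.isTopologicalBasis_of_isOpen_of_nhds ?_ fun y U hy hU => ?_
    · rintro _ ⟨p, rfl⟩; exact Metric.isOpen_ball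
    · obtain ⟨ε, hε, hεU⟩ := Metric.isOpen_iff.1 hU y hy
      obtain ⟨n, hn⟩ := exists_nat_one_div_lt hε
      exact ⟨_, ⟨(y, ⟨n⟩), rfl⟩, Metric.mem_ball_self (by positivity),
        (Metric.ball_subset_ball hn.le).trans hεU⟩
  refine (csInf_le' ⟨B, hB, rfl⟩ : topWeight Y ≤ #B).trans (mk_range_le.trans ?_)
  rw [mk_prod, lift_id, lift_id]
  exact (mul_le_mul' hY (by simpa using hm)).trans (mul_eq_self hm).le

/-- A point of a metric space is determined by a sequence of small basic neighbourhoods. -/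
theorem mk_le_of_topWeight_le {m : Cardinal.{u}} (hm : m ^ ℵ₀ ≤ m) (hY : topWeight Y ≤ m) :
    #Y ≤ m := by
  obtain ⟨B, hB, hBY⟩ := exists_isTopologicalBasis_mk_eq_topWeight Y
  choose b hb hyb hball using fun (y : Y) (n : ℕ) => hB.exists_subset_of_mem_open
    (Metric.mem_ball_self (x := y) (ε := 1 / (n + 1)) (by positivity)) Metric.isOpen_ball
  have hinj : Function.Injective fun (y : Y) (n : ℕ) => (⟨b y n, hb y n⟩ : B) := by
    intro y z hyz
    by_contra hne
    obtain ⟨n, hn⟩ := exists_nat_one_div_lt (dist_pos.2 hne)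
    have : b y n = b z n := congrArg Subtype.val (congrFun hyz n)
    exact (hball z n (this ▸ hyb y n)).not_gt hn
  calc #Y ≤ #(ℕ → B) := mk_le_of_injective hinj
    _ = topWeight Y ^ ℵ₀ := by simp [hBY]
    _ ≤ m ^ ℵ₀ := power_le_power_right hY
    _ ≤ m := hm

end Weight

/-! ### Discrete metric spaces -/

/-- A copy of a type, carrying the metric whose only nonzero distance is `1`. -/
def DiscreteCopy (D : Type u) : Type u := D

namespace DiscreteCopy

variable {D : Type u}

open Classical in
noncomputable instance : MetricSpace (DiscreteCopy D) where
  dist x y := if x = y then 0 else 1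
  dist_self x := if_pos rfl
  dist_comm x y := by simp only [eq_comm]
  dist_triangle x y z := by
    by_cases hxy : x = y
    · simp [hxy]
    · by_cases hyz : y = z
      · simp [hyz]
      · simp only [hxy, hyz, if_false]; split_ifs <;> norm_num
  eq_of_dist_eq_zero {x y} h := by by_contra hne; simp [hne] at h

theorem eq_of_dist_lt_one {x y : DiscreteCopy D} (h : dist x y < 1) : x = y := by
  by_contra hne
  exact h.ne (if_neg hne)

instance {G : Type*} [Group G] [MulAction G D] : MulAction G (DiscreteCopy D) :=
  inferInstanceAs (MulAction G D)

instance {G : Type*} [Group G] [MulAction G D] : IsIsometricSMul G (DiscreteCopy D) :=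
  ⟨fun g => Isometry.of_dist_eq fun x y => by
    classical exact if_congr (MulAction.injective g).eq_iff rfl rfl⟩

end DiscreteCopy

/-! ### Urysohn spaces and the extension property -/

section Urysohn

open KatetovTower

variable {m : Cardinal.{u}}

theorem KatetovTower.Tower.hasKatetovExtension_segment (X : Type u) [MetricSpace X] [Nonempty X] :
    HasKatetovExtension m (Tower X (Segment m)) :=
  Tower.hasKatetovExtension Segment.exists_le_mk

theorem KatetovTower.Tower.mk_segment_le (hm : ℵ₀ < m) (hpow : m ^< m = m) (X : Type u)
    [MetricSpace X] (hX : #X ≤ m) : #(Tower X (Segment m)) ≤ m :=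
  Tower.mk_le hm hpow hX (mk_ord_toType m).le (Segment.mk_lt hm.le)

theorem power_aleph0_le (hm : ℵ₀ < m) (hpow : m ^< m = m) : m ^ ℵ₀ ≤ m :=
  (le_powerlt m hm).trans_eq hpow

/-- A space of cardinality at most `m` with the extension property contains every space `Y` of
weight at most `m`, because it is isometric to the tower over `Y`. -/
theorem HasKatetovExtension.isUrysohnUniversal (hm : ℵ₀ < m) (hpow : m ^< m = m) {U : Type u}
    [MetricSpace U] (h : HasKatetovExtension m U) (hU : #U ≤ m) : IsUrysohnUniversal m U := by
  have huniv : IsStronglyCardUniversal m U := by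
    intro Y _ hY
    rcases isEmpty_or_nonempty Y with hY₀ | hY₀
    · exact ⟨isEmptyElim, isEmptyElim⟩
    have hYm := mk_le_of_topWeight_le (power_aleph0_le hm hpow) hY
    obtain ⟨e, -⟩ := (Tower.hasKatetovExtension_segment (m := m) Y).exists_isometryEquiv hm.le h
      (Tower.mk_segment_le hm hpow Y hYm) hU ∅ (by simpa using aleph0_pos.trans hm) nofun
    exact ⟨_, e.isometry.comp Tower.isometry_of⟩
  refine ⟨(topWeight_le_of_mk_le hm.le hU).antisymm ?_, h.isCardHomogeneous hm.le hU, huniv⟩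
  have hD : #(DiscreteCopy m.out) = m := mk_out m
  obtain ⟨i, hi⟩ := huniv (DiscreteCopy m.out) (topWeight_le_of_mk_le hm.le hD.le)
  rw [← hD]
  exact mk_le_topWeight (fun x => Metric.ball (i x) 1) i (fun _ => Metric.isOpen_ball)
    (fun _ => Metric.mem_ball_self one_pos)
    fun x y hxy => DiscreteCopy.eq_of_dist_lt_one (by rwa [Metric.mem_ball, hi.dist_eq] at hxy)

/-- The Katětov function is realized in the tower over `A`. The tower embeds into `U`, and the copy
of `A` in the image can be moved back to `A`. -/
theorem IsUrysohnUniversal.hasKatetovExtension (hm : ℵ₀ < m) (hpow : m ^< m = m) {U : Type u}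
    [MetricSpace U] (h : IsUrysohnUniversal m U) : HasKatetovExtension m U := by
  intro A hA f hf
  rcases A.eq_empty_or_nonempty with rfl | hne
  · obtain ⟨i, -⟩ := h.universal PUnit (topWeight_le_of_mk_le hm.le 
      ((mk_punit.trans_lt one_lt_aleph0).trans hm).le)
    exact ⟨i ⟨⟩, nofun⟩
  have : Nonempty A := hne.to_subtype
  have hof : Isometry (Tower.of : A → Tower A (Segment m)) := Tower.isometry_of
  obtain ⟨w, hw⟩ := Tower.hasKatetovExtension_segment (m := m) A (range Tower.of)
    (mk_range_le.trans_lt hA) (Function.extend Tower.of (fun a => f a) 0) (by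
      rintro _ ⟨a, rfl⟩ _ ⟨b, rfl⟩
      rw [hof.injective.extend_apply, hof.injective.extend_apply, hof.dist_eq]
      exact hf a a.2 b b.2)
  obtain ⟨i, hi⟩ := h.universal (Tower A (Segment m))
    (topWeight_le_of_mk_le hm.le (Tower.mk_segment_le hm hpow A hA.le))
  let e := (hi.comp hof).isometryEquivOnRange
  obtain ⟨g, hg⟩ := h.homogeneous _ A (mk_range_le.trans_lt hA) hA e.symm
  refine ⟨g (i w), fun a ha => ?_⟩
  have hga : g (i (Tower.of ⟨a, ha⟩)) = a := by
    have := hg (e ⟨a, ha⟩)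
    rwa [e.symm_apply_apply] at this
  conv_lhs => rw [← hga]
  rw [g.isometry.dist_eq, hi.dist_eq, hw _ ⟨_, rfl⟩, hof.injective.extend_apply]

end Urysohn

/-! ### Embedding groups -/

section Groups

open KatetovTower

variable {m : Cardinal.{u}} {G : Type u} [Group G] [TopologicalSpace G] [IsTopologicalGroup G]

/-- For uncountable `m`, the identity of a `P_m`-group has a base of neighbourhoods consisting of
open subgroups: intersect a sequence of neighbourhoods, each of whose quotients of two elements lie
in the preceding one. -/
theorem IsPSpace.exists_isOpen_subgroup (hm : ℵ₀ < m) (hG : IsPSpace m G) {W : Set G}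
    (hW : W ∈ 𝓝 (1 : G)) : ∃ H : Subgroup G, IsOpen (H : Set G) ∧ (H : Set G) ⊆ W := by
  choose d hd hdiv using fun V : {V : Set G // V ∈ 𝓝 1} => exists_nhds_split_inv V.2
  let V : ℕ → {V : Set G // V ∈ 𝓝 1} := fun n => Nat.rec ⟨W, hW⟩ (fun _ V => ⟨d V, hd V⟩) n
  have hV (n) (x) (hx : x ∈ (V (n + 1)).1) (y) (hy : y ∈ (V (n + 1)).1) : x / y ∈ (V n).1 :=
    hdiv (V n) x hx y hy
  have hopen : IsOpen (⋂₀ range fun n => interior (V n).1) := by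
    refine hG _ ?_ (forall_mem_range.2 fun n => isOpen_interior)
    exact (le_aleph0_iff_set_countable.2 (countable_range _)).trans_lt hm
  have hnhds : (⋂ n, (V n).1) ∈ 𝓝 (1 : G) := by
    refine mem_of_superset (hopen.mem_nhds ?_) ?_
    · rw [sInter_range]
      exact mem_iInter.2 fun n => mem_interior_iff_mem_nhds.2 (V n).2
    · rw [sInter_range]
      exact iInter_mono fun n => interior_subset
  let H : Subgroup G := Subgroup.ofDiv (⋂ n, (V n).1) ⟨1, mem_of_mem_nhds hnhds⟩
    fun x hx y hy => mem_iInter.2 fun n => by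
      rw [← div_eq_mul_inv]
      exact hV n x (mem_iInter.1 hx (n + 1)) y (mem_iInter.1 hy (n + 1))
  exact ⟨H, H.isOpen_of_mem_nhds hnhds, fun x hx => mem_iInter.1 hx 0⟩

/-- Translation by the elements of `G`, transported along an isometry of the space acted on. -/
noncomputable def isometryEquivHom {Z U : Type u} [MetricSpace Z] [MetricSpace U] [MulAction G Z]
    [IsIsometricSMul G Z] (e : Z ≃ᵢ U) : G →* (U ≃ᵢ U) where
  toFun g := (e.symm.trans (IsometryEquiv.constSMul g)).trans e
  map_one' := IsometryEquiv.ext fun u => by simp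
  map_mul' g h := IsometryEquiv.ext fun u => by simp [mul_smul, IsometryEquiv.mul_apply]

/-- An isometric action with open stabilizers is continuous for the topology of pointwise
convergence, and it is an embedding if the orbit maps recognize the neighbourhoods of `1`. -/
theorem exists_continuousMulEquiv_subgroup [T2Space G] {Z U : Type u} [MetricSpace Z]
    [MetricSpace U] [MulAction G Z] [IsIsometricSMul G Z] (e : Z ≃ᵢ U)
    (hopen : ∀ z : Z, IsOpen (MulAction.stabilizer G z : Set G))
    (hbase : ∀ W ∈ 𝓝 (1 : G), ∃ z : Z, ∃ ε > 0, ∀ g : G, dist (g • z) z < ε → g ∈ W) :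
    ∃ H : Subgroup (U ≃ᵢ U), Nonempty (G ≃ₜ* H) := by
  let φ : G →* (U ≃ᵢ U) := isometryEquivHom e
  have hφ (g u) : φ g u = e (g • e.symm u) := rfl
  have horbit (z : Z) : Continuous fun g : G => g • z := by
    refine continuous_iff_continuousAt.2 fun g => ?_
    refine tendsto_const_nhds.congr' ?_
    have : ∀ᶠ h in 𝓝 g, g⁻¹ * h ∈ MulAction.stabilizer G z :=
      (continuous_const_mul g⁻¹).continuousAt.eventually_mem
        ((hopen z).mem_nhds (by simp))
    filter_upwards [this] with h hh
    rwa [MulAction.mem_stabilizer_iff, mul_smul, inv_smul_eq_iff, eq_comm] at hh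
  have hcont : Continuous φ := continuous_induced_rng.2 <| continuous_pi fun u =>
    e.continuous.comp (horbit (e.symm u))
  have heval (u : U) : Continuous fun ψ : U ≃ᵢ U => ψ u :=
    (continuous_apply u).comp continuous_induced_dom
  have hind : IsInducing φ := by
    refine isInducing_iff_nhds.2 fun g => le_antisymm (hcont.tendsto g).le_comap fun W hW => ?_
    have hW' : (fun h => g * h) ⁻¹' W ∈ 𝓝 (1 : G) :=
      (continuous_const_mul g).continuousAt.preimage_mem_nhds (by simpa using hW)
    obtain ⟨z, ε, hε, hz⟩ := hbase _ hW'
    refine ⟨{ψ | dist (ψ (e z)) (φ g (e z)) < ε}, ?_, fun h hh => ?_⟩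
    · exact (isOpen_lt ((heval _).dist continuous_const) continuous_const).mem_nhds
        (by simpa using hε)
    · have hh : dist (φ h (e z)) (φ g (e z)) < ε := hh
      rw [hφ, hφ, e.isometry.dist_eq, e.symm_apply_apply, ← dist_smul g⁻¹, inv_smul_smul,
        ← mul_smul] at hh
      simpa using hz _ hh
  have hinj : Function.Injective φ := by
    have : T0Space G := inferInstance
    exact hind.injective
  let ψ := MonoidHom.ofInjective hinj
  refine ⟨φ.range, ⟨{ ψ with
    continuous_toFun := hcont.subtype_mk _
    continuous_invFun := hind.continuous_iff.2 (continuous_subtype_val.congr fun h => ?_) }⟩⟩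
  exact congrArg Subtype.val (ψ.apply_symm_apply h).symm

/-- The discrete sum of the coset spaces of a base of open subgroups is a metric space on which the
group acts, with open stabilizers that recognize the neighbourhoods of `1`. -/
theorem IsPSpace.exists_isIsometricSMul (hm : ℵ₀ < m) (hG : IsPSpace m G)
    (hw : topWeight G ≤ m) :
    ∃ (X : Type u) (_ : MetricSpace X) (_ : MulAction G X) (_ : IsIsometricSMul G X),
      #X ≤ m ∧ (∀ x : X, IsOpen (MulAction.stabilizer G x : Set G)) ∧
      ∀ W ∈ 𝓝 (1 : G), ∃ x : X, ∃ ε > 0, ∀ g : G, dist (g • x) x < ε → g ∈ W := by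
  obtain ⟨B, hB, hBG⟩ := exists_isTopologicalBasis_mk_eq_topWeight G
  choose H hHo hHb using fun b : {b : B // (1 : G) ∈ b.1} =>
    hG.exists_isOpen_subgroup hm ((hB.isOpen b.1.2).mem_nhds b.2)
  refine ⟨DiscreteCopy (Σ b, G ⧸ H b), inferInstance, inferInstance, inferInstance, ?_, ?_, ?_⟩
  · have hcoset (b) : #(G ⧸ H b) ≤ m := by
      refine (mk_le_topWeight (X := G) (fun q : G ⧸ H b => {g | (g : G ⧸ H b) = q}) Quotient.out
        (fun q => ?_) (fun q => Quotient.out_eq q)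
        fun p q h => (Quotient.out_eq p).symm.trans h).trans hw
      obtain ⟨a, rfl⟩ := QuotientGroup.mk_surjective q
      simp only [eq_comm (b := (a : G ⧸ H b)), QuotientGroup.eq]
      exact (hHo b).preimage (continuous_const_mul a⁻¹)
    change #(Σ b, G ⧸ H b) ≤ m
    rw [mk_sigma]
    refine (sum_le_sum _ (fun _ => m) hcoset).trans ?_
    rw [sum_const']
    exact (mul_le_mul_left ((mk_subtype_le _).trans (hBG.trans_le hw)) m).trans
      (mul_eq_self hm.le).le
  · rintro ⟨b, q⟩
    obtain ⟨a, rfl⟩ := QuotientGroup.mk_surjective q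
    convert (hHo b).preimage ((continuous_const_mul a⁻¹).comp (continuous_mul_const a)) using 1
    ext g
    have : g • (⟨b, (a : G ⧸ H b)⟩ : Σ b, G ⧸ H b) = ⟨b, (a : G ⧸ H b)⟩ ↔
        a⁻¹ * (g * a) ∈ H b := by
      rw [Sigma.smul_mk, Sigma.mk.inj_iff, heq_eq_eq, eq_self_iff_true, true_and, eq_comm,
        ← QuotientGroup.eq]
      rfl
    exact this
  · intro W hW
    obtain ⟨b, hb, h1b, hbW⟩ := hB.mem_nhds_iff.1 hW
    refine ⟨(⟨⟨⟨b, hb⟩, h1b⟩, ((1 : G) : G ⧸ H ⟨⟨b, hb⟩, h1b⟩)⟩ : Σ b, G ⧸ H b), 1, one_pos,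
      fun g hg => hbW (hHb ⟨⟨b, hb⟩, h1b⟩ ?_)⟩
    have := DiscreteCopy.eq_of_dist_lt_one hg
    have := (eq_of_heq (Sigma.mk.inj_iff.1 this).2).symm
    simpa using QuotientGroup.eq.1 this

end Groups

theorem mainTheorem10 (m : Cardinal.{u}) (hm : Cardinal.aleph0 < m)
    (hpow : Cardinal.powerlt m m = m) :
    (∃ (U : Type u) (_ : MetricSpace U), IsUrysohnUniversal m U) ∧
    ∀ (U : Type u) [MetricSpace U], IsUrysohnUniversal m U →
      ∀ (G : Type u) [Group G] [TopologicalSpace G] [IsTopologicalGroup G] [T2Space G],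
        IsPSpace m G → topWeight G ≤ m →
        ∃ H : Subgroup (U ≃ᵢ U), Nonempty (G ≃ₜ* H) := by
  constructor
  · exact ⟨_, _, (KatetovTower.Tower.hasKatetovExtension_segment PUnit).isUrysohnUniversal hm hpow
      (KatetovTower.Tower.mk_segment_le hm hpow PUnit
        ((mk_punit.trans_lt one_lt_aleph0).trans hm).le)⟩
  · intro U _ hU G _ _ _ _ hG hw
    obtain ⟨X, _, _, _, hX, hopen, hbase⟩ := hG.exists_isIsometricSMul hm hw
    have : Nonempty X := let ⟨x, _⟩ := hbase univ univ_mem; ⟨x⟩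
    have hUm : #U ≤ m := mk_le_of_topWeight_le (power_aleph0_le hm hpow) hU.weight_eq.le
    have hX' : HasKatetovExtension m (KatetovTower.Tower X (KatetovTower.Segment m)) :=
      KatetovTower.Tower.hasKatetovExtension_segment X
    obtain ⟨e, -⟩ := hX'.exists_isometryEquiv hm.le (hU.hasKatetovExtension hm hpow)
      (KatetovTower.Tower.mk_segment_le hm hpow X hX) hUm ∅
      (by simpa using aleph0_pos.trans hm) nofun
    refine exists_continuousMulEquiv_subgroup e
      (KatetovTower.Tower.isOpen_stabilizer hG (KatetovTower.Segment.mk_lt hm.le) hopen)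
      fun W hW => ?_
    obtain ⟨x, ε, hε, hx⟩ := hbase W hW
    refine ⟨KatetovTower.Tower.of x, ε, hε, fun g hg => hx g ?_⟩
    rwa [KatetovTower.Tower.smul_of, KatetovTower.Tower.isometry_of.dist_eq] at hg
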